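/- Let $K\ge 1$, let $0\le v_1<v_2<\dots<v_K$ be real numbers with $v_K>0$, and for $n\ge 1$ let $G_n$ be the path with users $u_1,\dots,u_n$ and edges $e_i=\{u_i,u_{i+1}\}$, $1\le i\le n-1$, whose weights $w_1,\dots,w_{n-1}$ are independent and uniformly distributed on $\{v_1,\dots,v_K\}$. The weight of a matching is the sum of the weights of its edges. Let $f^\star(G_n,W)$ be the maximum weight of a matching, and let $\hat f(G_n,W)$ be the weight of the matching produced by the following greedy algorithm: in each iteration every unmatched user that has an unmatched neighbor proposes to the unmatched neighbor joined to it by the edge of largest weight (ties are resolved in favor of the left neighbor), and then all pairs of users that proposed to each other are matched; this is repeated until no two unmatched users are adjacent. Let $$PR(G_n)=\frac{\mathbb{E}_W[\hat f(G_n,W)]}{\mathbb{E}_W[f^\star(G_n,W)]}$$ be the average performance ratio (defined for $n\ge2$). Then $\lim_{n\to\infty}PR(G_n)$ exists and $$\lim_{n\to\infty}PR(G_n)\;\ge\; R_K(v):=\frac{\sum_{k=1}^{K} v_{k}\,\frac{(K-1)^{K-k}}{(K+1)^{K-k+1}}}{\sum_{k=1}^{K} v_{k}\,\frac{K}{(2K+1-k)(2K-k)}}\;\ge\;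 1-\Big(\frac{K-1}{K+1}\Big)^K\;\ge\; 1-e^{-2}\approx 86.5\%$$ (with $0^0=1$). Moreover, for fixed $K$, the second inequality becomes an equality in the limit $v_K/v_1\to1$: for every $\varepsilon>0$ there is $\delta>0$ such that $\big|R_K(v)-\big(1-(\frac{K-1}{K+1})^K\big)\big|<\varepsilon$ for all $0<v_1<\dots<v_K$ with $v_K/v_1<1+\delta$. -/

import Mathlib

open Filter Topology

namespace D2D

section Graph

variable {V : Type*} (G : SimpleGraph V)

/-- A matching, as the set of the selected edges: every user lies on at most one selected edge. -/
def IsMatching (M : Set G.edgeSet) : Prop :=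
  ∀ u : V, ∀ e ∈ M, ∀ f ∈ M, u ∈ (e : Sym2 V) → u ∈ (f : Sym2 V) → e = f

open Classical in
/-- The total weight of the selected edges. -/
noncomputable def totalWeight [Fintype V] (w : G.edgeSet → ℝ) (M : Set G.edgeSet) : ℝ :=
  ∑ e : G.edgeSet, if e ∈ M then w e else 0

/-- The weight of an optimal matching, that is, the maximum of the total weight over the
(finitely many) matchings of `G`. -/
noncomputable def optimalWeight [Fintype V] (w : G.edgeSet → ℝ) : ℝ :=
  sSup (totalWeight G w '' {M | IsMatching G M})

/-- User `u` is not yet matched when the edges in `M` have been selected. -/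
def Unmatched (M : Set G.edgeSet) (u : V) : Prop :=
  ∀ e ∈ M, u ∉ (e : Sym2 V)

/-- Proposal phase: the unmatched user `u` proposes to `v`, which is, among the unmatched
neighbours of `u`, the one whose edge to `u` has the largest weight; ties are resolved in favour
of the smallest user (on a path numbered from left to right: the left neighbour). -/
def Proposes [LinearOrder V] (w : G.edgeSet → ℝ) (M : Set G.edgeSet) (u v : V) : Prop :=
  Unmatched G M u ∧ Unmatched G M v ∧ ∃ h : G.Adj u v,
    ∀ (v' : V) (h' : G.Adj u v'), Unmatched G M v' →
      w ⟨s(u, v'), h'⟩ < w ⟨s(u, v), h⟩ ∨ (w ⟨s(u, v'), h'⟩ = w ⟨s(u, v), h⟩ ∧ v ≤ v')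

/-- One iteration of the greedy algorithm. Matching phase: all pairs of users that proposed
to each other are matched. -/
def greedyStep [LinearOrder V] (w : G.edgeSet → ℝ) (M : Set G.edgeSet) : Set G.edgeSet :=
  M ∪ {e | ∃ u v : V, (e : Sym2 V) = s(u, v) ∧ Proposes G w M u v ∧ Proposes G w M v u}

/-- The output of the greedy algorithm: all edges selected in some iteration, starting from the
empty matching. -/
def greedyMatching [LinearOrder V] (w : G.edgeSet → ℝ) : Set G.edgeSet :=
  ⋃ t : ℕ, (greedyStep G w)^[t] ∅

/-- The total weight of the greedy matching. -/
noncomputable def greedyWeight [Fintype V] [LinearOrder V] (w : G.edgeSet → ℝ) : ℝ :=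
  totalWeight G w (greedyMatching G w)

open Classical in
/-- Expectation of `F W` when the edge weights `W e` are independent and identically distributed
with `Pr (W e = v k) = p k`; the sum runs over all assignments `c` of a weight index to each
edge. -/
noncomputable def expectation [Fintype V] {K : ℕ} (p v : Fin K → ℝ)
    (F : (G.edgeSet → ℝ) → ℝ) : ℝ :=
  ∑ c : G.edgeSet → Fin K, (∏ e : G.edgeSet, p (c e)) * F (fun e => v (c e))

/-- The average performance ratio of the greedy algorithm on `G`. -/
noncomputable def performanceRatio [Fintype V] [LinearOrder V] {K : ℕ} (p v : Fin K → ℝ) : ℝ :=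
  expectation G p v (greedyWeight G) / expectation G p v (optimalWeight G)

end Graph

/-- The explicit ratio of weighted sums of `v_1, …, v_K`; the index `i : Fin K` stands for
`k = i + 1`. -/
noncomputable def uniformBound (K : ℕ) (v : Fin K → ℝ) : ℝ :=
  (∑ i : Fin K, v i * (((K : ℝ) - 1) ^ (K - ((i : ℕ) + 1)) /
      ((K : ℝ) + 1) ^ (K - ((i : ℕ) + 1) + 1))) /
  (∑ i : Fin K, v i * ((K : ℝ) /
      ((2 * (K : ℝ) + 1 - ((i : ℝ) + 1)) * (2 * (K : ℝ) - ((i : ℝ) + 1)))))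

end D2D

/-! Number the edges of a path from left to right and replace each weight by its level in `Fin K`.
Mutual proposals produce the unique stable matching: an edge is absent exactly when a selected
neighbouring edge is preferred to it at the common user. Preferences are acyclic (higher level
first, then further left), so `greedyMatching_eq` identifies the output with any matching of this
kind. On a path it is `Selected`: edge `i` is chosen iff the part to its left does not match its
left end at a level at least `c i`, and the part to its right does not match its right end at a
level above `c i`. The asymmetry between "at least" and "above" is the tie rule.

Given `c i`, the two conditions concern disjoint blocks of weights and are independent. Their
probabilities obey linear recursions with fixed points `leftLim` and `rightLim`. The right one is
reached after finitely many steps, and the left one is needed only on average over the path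
(`abs_sum_leftProb_sub_le`). Hence the expected greedy weight per user tends to `∑ k, v k *
greedyFreq K k`.

For the optimum, write `v` as a nonnegative combination of indicators of "level at least `k`". A
matching contains at most as many such edges as a left-to-right sweep through them selects, and the
mean of the sweep solves a one-step recursion. This gives `avg_sparseOpt_le`. The limit per user
exists by Fekete's lemma, since deleting one edge cuts a path into two independent paths. Dividing
the limits yields `uniformBound`.

The same decomposition of `v` reduces the second inequality to one scalar inequality per level,
`bound_mul_le`, which is an equality at the lowest level. The exponential bound is a logarithm
estimate. -/

namespace D2D

/-! ### The explicit ratio: inequalities between finite sums -/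

section Bound

/-- A nonnegative monotone sequence is the sequence of partial sums of nonnegative increments. -/
lemma exists_increments {K : ℕ} (v : Fin K → ℝ) (hv : Monotone v) (h0 : ∀ k, 0 ≤ v k) :
    ∃ D : Fin K → ℝ, (∀ k, 0 ≤ D k) ∧ ∀ i, v i = ∑ k, if k ≤ i then D k else 0 := by
  induction K with
  | zero => exact ⟨v, h0, fun i => i.elim0⟩
  | succ K ih =>
    obtain ⟨D, hD, h⟩ := ih (fun i => v i.castSucc) (fun i j hij => hv (by simpa using hij))
      (fun i => h0 _)
    rcases Nat.eq_zero_or_pos K with rfl | hK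
    · exact ⟨v, h0, fun i => by
        obtain rfl : i = 0 := Fin.ext (by omega)
        simp⟩
    have hlast : ∑ k, D k = v (Fin.castSucc ⟨K - 1, by omega⟩) := by
      rw [h]
      refine Finset.sum_congr rfl fun k _ => ?_
      rw [if_pos]
      exact Fin.le_def.2 (by have := k.2; simp; omega)
    refine ⟨Fin.snoc D (v (Fin.last K) - ∑ k, D k), ?_, ?_⟩
    · intro k
      refine Fin.lastCases ?_ (fun k => ?_) k
      · rw [Fin.snoc_last, hlast, sub_nonneg]
        exact hv (Fin.le_last _)
      · simpa using hD k
    · intro i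
      refine Fin.lastCases ?_ (fun i => ?_) i
      · simp [Fin.sum_univ_castSucc, Fin.le_last]
      · have := h i
        simp only [Fin.sum_univ_castSucc, Fin.snoc_castSucc, Fin.castSucc_le_castSucc_iff]
        rw [this, if_neg (by simp), add_zero]

lemma sum_tail_telescope {K : ℕ} (g : ℕ → ℝ) (hg : g K = 0) (k : Fin K) :
    ∑ i : Fin K, (if k ≤ i then g i - g (i + 1) else 0) = g k := by
  have hk := k.2
  have h : ∀ m, (k : ℕ) ≤ m →
      ∑ i ∈ Finset.range m, (if (k : ℕ) ≤ i then g i - g (i + 1) else 0) = g k - g m := by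
    intro m hm
    induction m, hm using Nat.le_induction with
    | base =>
      rw [sub_self]
      refine Finset.sum_eq_zero fun i hi => ?_
      rw [if_neg (by simpa using hi)]
    | succ m hm ih => rw [Finset.sum_range_succ, ih, if_pos hm]; ring
  have := h K hk.le
  rw [Finset.sum_range, hg, sub_zero] at this
  exact this

/-- Abel summation: inequalities linear in `v` need only be checked on tail sums of the
coefficients. -/
lemma sum_mul_eq_sum_increments {K : ℕ} {v D : Fin K → ℝ}
    (h : ∀ i, v i = ∑ k, if k ≤ i then D k else 0) (α : Fin K → ℝ) :
    ∑ i, v i * α i = ∑ k, D k * ∑ i, if k ≤ i then α i else 0 := by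
  simp_rw [h, Finset.sum_mul, Finset.mul_sum]
  rw [Finset.sum_comm]
  refine Finset.sum_congr rfl fun k _ => Finset.sum_congr rfl fun i _ => ?_
  split_ifs <;> simp

/-- The fraction of the users that remain unmatched after one weight level. -/
noncomputable def survival (K : ℕ) : ℝ := ((K : ℝ) - 1) / ((K : ℝ) + 1)

/-- The limit frequency of the edges of level `i` in the greedy matching. -/
noncomputable def greedyFreq (K : ℕ) (i : Fin K) : ℝ :=
  ((K : ℝ) - 1) ^ (K - ((i : ℕ) + 1)) / ((K : ℝ) + 1) ^ (K - ((i : ℕ) + 1) + 1)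

/-- The increments in `i` of the limit frequency of a maximum matching of the edges of level at
least `i`. -/
noncomputable def matchFreq (K : ℕ) (i : Fin K) : ℝ :=
  (K : ℝ) / ((2 * (K : ℝ) + 1 - ((i : ℝ) + 1)) * (2 * (K : ℝ) - ((i : ℝ) + 1)))

lemma uniformBound_eq (K : ℕ) (v : Fin K → ℝ) :
    uniformBound K v = (∑ i, v i * greedyFreq K i) / ∑ i, v i * matchFreq K i := rfl

lemma survival_nonneg {K : ℕ} (hK : 1 ≤ K) : 0 ≤ survival K := by
  have : (1 : ℝ) ≤ K := by exact_mod_cast hK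
  exact div_nonneg (by linarith) (by linarith)

lemma survival_le_one {K : ℕ} : survival K ≤ 1 := by
  have : (0 : ℝ) ≤ K := by positivity
  exact (div_le_one (by linarith)).2 (by linarith)

lemma greedyFreq_tail {K : ℕ} (k : Fin K) :
    ∑ i, (if k ≤ i then greedyFreq K i else 0) = (1 - survival K ^ (K - (k : ℕ))) / 2 := by
  rw [← sum_tail_telescope (fun i => (1 - survival K ^ (K - i)) / 2) (by simp) k]
  refine Finset.sum_congr rfl fun i _ => ?_
  congr 1
  have hi := i.2
  obtain ⟨j, hj⟩ : ∃ j, K - ((i : ℕ) + 1) = j := ⟨_, rfl⟩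
  have hj' : K - (i : ℕ) = j + 1 := by omega
  have : (0 : ℝ) < (K : ℝ) + 1 := by positivity
  rw [greedyFreq, hj, hj', survival, div_pow, div_pow]
  field_simp
  ring

lemma matchFreq_tail {K : ℕ} (k : Fin K) :
    ∑ i, (if k ≤ i then matchFreq K i else 0) = ((K : ℝ) - k) / (2 * K - k) := by
  rw [← sum_tail_telescope (fun i => ((K : ℝ) - i) / (2 * K - i)) (by simp) k]
  refine Finset.sum_congr rfl fun i _ => ?_
  congr 1
  have hi : ((i : ℕ) : ℝ) + 1 ≤ K := by exact_mod_cast i.2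
  have hi0 : (0 : ℝ) ≤ ((i : ℕ) : ℝ) := by positivity
  have h1 : (0 : ℝ) < 2 * (K : ℝ) + 1 - ((i : ℝ) + 1) := by linarith
  have h2 : (0 : ℝ) < 2 * (K : ℝ) - ((i : ℝ) + 1) := by linarith
  have h3 : (0 : ℝ) < 2 * (K : ℝ) - (i : ℝ) := by linarith
  rw [matchFreq, div_sub_div _ _ h3.ne' (by push_cast; exact h2.ne'),
    div_eq_div_iff (by positivity) (by push_cast; positivity)]
  push_cast
  ring

/-- This is what `survival_ratio_step` becomes after multiplication by `K + 1` and elimination of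
`survival K ^ (j + 1)`. The left side is nonincreasing in `j`, with equality at `j = 0`. -/
lemma survival_pow_mul_le {K : ℕ} (hK : 1 ≤ K) (j : ℕ) :
    survival K ^ j * ((K : ℝ) * (K + 1) + 2 * j * (K + j + 1)) ≤ K * (K + 1) := by
  have hK' : (1 : ℝ) ≤ K := by exact_mod_cast hK
  induction j with
  | zero => simp
  | succ j ih =>
    refine le_trans ?_ ih
    have h0 : 0 ≤ survival K ^ j := pow_nonneg (survival_nonneg hK) j
    rw [pow_succ, mul_assoc]
    refine mul_le_mul_of_nonneg_left ?_ h0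
    rw [survival, div_mul_eq_mul_div, div_le_iff₀ (by linarith)]
    push_cast
    have hj : (0 : ℝ) ≤ j := by positivity
    nlinarith [mul_nonneg hj hj]

/-- With denominators cleared, this says that `(1 - survival K ^ j) * (K + j) / j` does not increase
with `j`. -/
lemma survival_ratio_step {K : ℕ} (hK : 1 ≤ K) (j : ℕ) :
    (1 - survival K ^ (j + 1)) * (K + (j + 1)) * j ≤
      (1 - survival K ^ j) * (K + j) * (j + 1) := by
  have hK' : (1 : ℝ) ≤ K := by exact_mod_cast hK
  have h := survival_pow_mul_le hK j
  have e : survival K ^ (j + 1) * (K + 1) = survival K ^ j * (K - 1) := by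
    rw [pow_succ, survival]; field_simp
  refine le_of_mul_le_mul_right ?_ (by linarith : (0 : ℝ) < K + 1)
  linear_combination h - (K + j + 1) * j * e

/-- The quotient of the greedy tail by the matching tail for the top `j` levels decreases in `j`, so
it is at least its value at `j = K`, where the matching tail is `1 / 2`. -/
lemma bound_mul_le {K : ℕ} (hK : 1 ≤ K) (j : ℕ) (hj : 1 ≤ j) (hjK : j ≤ K) :
    (1 - survival K ^ K) * (j / (K + j)) ≤ (1 - survival K ^ j) / 2 := by
  have hK' : (1 : ℝ) ≤ K := by exact_mod_cast hK
  have key : ∀ m, j ≤ m →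
      (1 - survival K ^ m) * (K + m) * j ≤ (1 - survival K ^ j) * (K + j) * m := by
    intro m hm
    induction m, hm using Nat.le_induction with
    | base => exact le_rfl
    | succ m hm ih =>
      have hm0 : (0 : ℝ) < m := by exact_mod_cast (by omega : 0 < m)
      have hj0 : (0 : ℝ) < j := by exact_mod_cast (by omega : 0 < j)
      have hs := survival_ratio_step hK m
      push_cast
      refine le_of_mul_le_mul_right ?_ hm0
      have h1 := mul_le_mul_of_nonneg_right hs hj0.le
      have h2 := mul_le_mul_of_nonneg_right ih (by linarith : (0 : ℝ) ≤ (m : ℝ) + 1)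
      nlinarith
  have h := key K hjK
  have hj0 : (0 : ℝ) < j := by exact_mod_cast (by omega : 0 < j)
  rw [← mul_div_assoc, div_le_div_iff₀ (by linarith) (by norm_num)]
  refine le_of_mul_le_mul_right ?_ (by linarith : (0 : ℝ) < K)
  nlinarith

lemma matchFreq_pos {K : ℕ} (i : Fin K) : 0 < matchFreq K i := by
  have hi : ((i : ℕ) : ℝ) + 1 ≤ K := by exact_mod_cast i.2
  have hi0 : (0 : ℝ) ≤ ((i : ℕ) : ℝ) := by positivity
  have h1 : (0 : ℝ) < 2 * (K : ℝ) + 1 - ((i : ℝ) + 1) := by linarith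
  have h2 : (0 : ℝ) < 2 * (K : ℝ) - ((i : ℝ) + 1) := by linarith
  rw [matchFreq]
  exact div_pos (by linarith) (mul_pos h1 h2)

lemma greedyFreq_nonneg {K : ℕ} (i : Fin K) : 0 ≤ greedyFreq K i := by
  have hi : (1 : ℝ) ≤ K := by exact_mod_cast (by have := i.2; omega : 1 ≤ K)
  exact div_nonneg (pow_nonneg (by linarith) _) (by positivity)

lemma sum_mul_matchFreq_pos {K : ℕ} {v : Fin K → ℝ} (h0 : ∀ k, 0 ≤ v k) (hp : ∃ k, 0 < v k) :
    0 < ∑ i, v i * matchFreq K i := by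
  obtain ⟨k, hk⟩ := hp
  exact Finset.sum_pos' (fun i _ => mul_nonneg (h0 i) (matchFreq_pos i).le)
    ⟨k, Finset.mem_univ _, mul_pos hk (matchFreq_pos k)⟩

lemma sum_mul_greedyFreq_pos {K : ℕ} {v : Fin K → ℝ} (hv : Monotone v) (h0 : ∀ k, 0 ≤ v k)
    (hp : ∃ k, 0 < v k) : 0 < ∑ i, v i * greedyFreq K i := by
  obtain ⟨k, hk⟩ := hp
  have hk2 := k.2
  refine Finset.sum_pos' (fun i _ => mul_nonneg (h0 i) (greedyFreq_nonneg i))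
    ⟨⟨K - 1, by omega⟩, Finset.mem_univ _, mul_pos (hk.trans_le (hv ?_)) ?_⟩
  · exact Fin.le_def.2 (by simp; omega)
  · have : K - (K - 1 + 1) = 0 := by omega
    simp only [greedyFreq, this]
    positivity

lemma le_uniformBound {K : ℕ} (hK : 1 ≤ K) {v : Fin K → ℝ} (hv : Monotone v)
    (h0 : ∀ k, 0 ≤ v k) (hp : ∃ k, 0 < v k) : 1 - survival K ^ K ≤ uniformBound K v := by
  rw [uniformBound_eq, le_div_iff₀ (sum_mul_matchFreq_pos h0 hp)]
  obtain ⟨D, hD, h⟩ := exists_increments v hv h0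
  rw [sum_mul_eq_sum_increments h, sum_mul_eq_sum_increments h, Finset.mul_sum]
  refine Finset.sum_le_sum fun k _ => ?_
  rw [greedyFreq_tail, matchFreq_tail, mul_left_comm]
  refine mul_le_mul_of_nonneg_left ?_ (hD k)
  have hk := k.2
  have := bound_mul_le hK (K - k) (by omega) (by omega)
  rw [Nat.cast_sub hk.le] at this
  rwa [← add_sub_assoc, ← two_mul] at this

lemma survival_pow_le_exp {K : ℕ} (hK : 1 ≤ K) : survival K ^ K ≤ Real.exp (-2) := by
  rcases hK.eq_or_lt with rfl | hK
  · simp [survival, Real.exp_nonneg]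
  have hK' : (2 : ℝ) ≤ K := by exact_mod_cast hK
  have hK1 : (0 : ℝ) < K - 1 := by linarith
  -- This `x` makes `1 + x` the inverse of `survival K`, and the bound `2 * x / (x + 2)` equals
  -- exactly `2 / K`.
  have h := Real.le_log_one_add_of_nonneg (x := 2 / ((K : ℝ) - 1)) (by positivity)
  have e1 : 2 * (2 / ((K : ℝ) - 1)) / (2 / ((K : ℝ) - 1) + 2) = 2 / K := by
    field_simp
    ring
  have e2 : 1 + 2 / ((K : ℝ) - 1) = (survival K)⁻¹ := by
    rw [survival]; field_simp; ring
  have hs : 0 < survival K := div_pos hK1 (by linarith)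
  rw [e1, e2, Real.log_inv] at h
  rw [← Real.exp_log hs, ← Real.exp_nat_mul, Real.exp_le_exp]
  have : (K : ℝ) * (2 / K) = 2 := by field_simp
  nlinarith

lemma abs_exp_bound : |(1 - Real.exp (-2)) - 0.865| < 0.0005 := by
  have h1 := Real.exp_one_gt_d9
  have h2 := Real.exp_one_lt_d9
  have e : Real.exp (-2) * (Real.exp 1 * Real.exp 1) = 1 := by
    rw [← Real.exp_add, ← Real.exp_add]; norm_num
  have hp := Real.exp_pos (-2)
  have h3 : (7.389 : ℝ) ≤ Real.exp 1 * Real.exp 1 := by nlinarith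
  have h4 : Real.exp 1 * Real.exp 1 ≤ (7.39 : ℝ) := by nlinarith
  rw [abs_lt]
  constructor <;> nlinarith

lemma sum_matchFreq {K : ℕ} (hK : 1 ≤ K) : ∑ i, matchFreq K i = 1 / 2 := by
  have hK' : (1 : ℝ) ≤ K := by exact_mod_cast hK
  have := matchFreq_tail (⟨0, hK⟩ : Fin K)
  simp only [Fin.le_def, Nat.zero_le, if_true, Nat.cast_zero, sub_zero] at this
  rw [this]
  field_simp

lemma sum_greedyFreq {K : ℕ} (hK : 1 ≤ K) : ∑ i, greedyFreq K i = (1 - survival K ^ K) / 2 := by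
  have := greedyFreq_tail (⟨0, hK⟩ : Fin K)
  simpa only [Fin.le_def, Nat.zero_le, if_true, Nat.sub_zero] using this

/-- Replacing all weights by the largest in the numerator and by the smallest in the denominator
costs a factor below `1 + ε`. As the ratio for equal weights is at most `1`, `δ = ε` suffices. -/
lemma abs_uniformBound_sub_lt {K : ℕ} (hK : 1 ≤ K) {ε : ℝ} (hε : 0 < ε) {v : Fin K → ℝ}
    (hv : Monotone v) (h0 : 0 < v ⟨0, hK⟩)
    (hr : v ⟨K - 1, Nat.sub_lt hK Nat.one_pos⟩ / v ⟨0, hK⟩ < 1 + ε) :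
    |uniformBound K v - (1 - survival K ^ K)| < ε := by
  set a := v ⟨0, hK⟩
  set b := v ⟨K - 1, Nat.sub_lt hK Nat.one_pos⟩
  have ha : ∀ i, a ≤ v i := fun i => hv (Fin.le_def.2 (Nat.zero_le _))
  have hb : ∀ i, v i ≤ b := fun i => hv (Fin.le_def.2 (by have := i.2; simp; omega))
  have hab : b < (1 + ε) * a := (div_lt_iff₀ h0).1 hr
  have hpos : ∀ i, 0 < v i := fun i => h0.trans_le (ha i)
  have bd : ∀ α : Fin K → ℝ, (∀ i, 0 ≤ α i) →
      a * ∑ i, α i ≤ ∑ i, v i * α i ∧ ∑ i, v i * α i ≤ b * ∑ i, α i := by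
    intro α hα
    rw [Finset.mul_sum, Finset.mul_sum]
    exact ⟨Finset.sum_le_sum fun i _ => mul_le_mul_of_nonneg_right (ha i) (hα i),
      Finset.sum_le_sum fun i _ => mul_le_mul_of_nonneg_right (hb i) (hα i)⟩
  obtain ⟨n1, n2⟩ := bd _ (greedyFreq_nonneg (K := K))
  obtain ⟨d1, d2⟩ := bd _ (fun i => (matchFreq_pos i).le)
  rw [sum_greedyFreq hK] at n1 n2
  rw [sum_matchFreq hK] at d1 d2
  have hlow := le_uniformBound hK hv (fun i => (hpos i).le) ⟨_, h0⟩
  have hden := sum_mul_matchFreq_pos (fun i => (hpos i).le) ⟨_, h0⟩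
  rw [abs_of_nonneg (sub_nonneg.2 hlow), uniformBound_eq, sub_lt_iff_lt_add,
    div_lt_iff₀ hden]
  have hs0 : 0 ≤ survival K ^ K := pow_nonneg (survival_nonneg hK) K
  have hs1 : survival K ^ K ≤ 1 := pow_le_one₀ (survival_nonneg hK) survival_le_one
  generalize survival K ^ K = s at *
  have h1 : b * ((1 - s) / 2) ≤ (1 + ε) * a * ((1 - s) / 2) :=
    mul_le_mul_of_nonneg_right hab.le (by linarith)
  have h2 : (ε + (1 - s)) * (a * (1 / 2)) ≤ (ε + (1 - s)) * ∑ i, v i * matchFreq K i :=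
    mul_le_mul_of_nonneg_left d1 (by linarith)
  -- The slack is proportional to `ε * s`; for `s = 0` strictness comes from `hab` instead.
  rcases hs0.eq_or_lt with rfl | hs
  · nlinarith
  · nlinarith [mul_pos hs (mul_pos hε h0)]

end Bound

/-! ### Averages over i.i.d. uniform sequences -/

section Average

variable {α : Type*}

/-- The sequence `a, c 0, c 1, …`. -/
def consSeq (a : α) (c : ℕ → α) : ℕ → α
  | 0 => a
  | n + 1 => c n

@[simp] lemma consSeq_zero (a : α) (c : ℕ → α) : consSeq a c 0 = a := rfl

@[simp] lemma consSeq_succ (a : α) (c : ℕ → α) (n : ℕ) : consSeq a c (n + 1) = c n := rfl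

variable [Inhabited α]

/-- The sequence that starts with the tuple `c`. -/
def extendSeq {n : ℕ} (c : Fin n → α) (j : ℕ) : α := if h : j < n then c ⟨j, h⟩ else default

lemma extendSeq_cons {n : ℕ} (a : α) (c : Fin n → α) :
    extendSeq (Fin.cons a c : Fin (n + 1) → α) = consSeq a (extendSeq c) := by
  funext j
  cases j with
  | zero => simp [extendSeq]
  | succ j =>
    by_cases h : j < n
    · rw [consSeq_succ, extendSeq, extendSeq, dif_pos h, dif_pos (Nat.succ_lt_succ h)]
      exact Fin.cons_succ (α := fun _ => α) a c ⟨j, h⟩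
    · have h' : ¬ j + 1 < n + 1 := by omega
      rw [consSeq_succ, extendSeq, extendSeq, dif_neg h, dif_neg h']

variable [Fintype α]

/-- The expectation of `F c` when the first `n` terms of the sequence `c` are independent and
uniformly distributed on `α`. -/
noncomputable def avg : ℕ → ((ℕ → α) → ℝ) → ℝ
  | 0, F => F fun _ => default
  | n + 1, F => (∑ a, avg n fun c => F (consSeq a c)) / Fintype.card α

lemma avg_add (n : ℕ) (F H : (ℕ → α) → ℝ) :
    avg n (fun c => F c + H c) = avg n F + avg n H := by
  induction n generalizing F H with
  | zero => rfl
  | succ n ih => simp only [avg, ih, Finset.sum_add_distrib, add_div]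

lemma avg_const_mul (n : ℕ) (x : ℝ) (F : (ℕ → α) → ℝ) :
    avg n (fun c => x * F c) = x * avg n F := by
  induction n generalizing F with
  | zero => rfl
  | succ n ih => simp only [avg, ih, ← Finset.mul_sum, mul_div_assoc]

lemma avg_const (n : ℕ) (x : ℝ) : avg n (fun _ : ℕ → α => x) = x := by
  induction n with
  | zero => rfl
  | succ n ih =>
    have : (Fintype.card α : ℝ) ≠ 0 := by exact_mod_cast Fintype.card_ne_zero
    simp only [avg, ih, Finset.sum_const, Finset.card_univ, nsmul_eq_mul]
    field_simp

lemma avg_sub (n : ℕ) (F H : (ℕ → α) → ℝ) :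
    avg n (fun c => F c - H c) = avg n F - avg n H := by
  have := avg_add n F (fun c => (-1) * H c)
  rw [avg_const_mul] at this
  simpa [sub_eq_add_neg] using this

lemma avg_sum {ι : Type*} (n : ℕ) (s : Finset ι) (F : ι → (ℕ → α) → ℝ) :
    avg n (fun c => ∑ i ∈ s, F i c) = ∑ i ∈ s, avg n (F i) := by
  classical
  induction s using Finset.induction_on with
  | empty => simpa using avg_const n 0
  | insert i s hi ih => simp only [Finset.sum_insert hi, avg_add, ih]

lemma avg_mono {n : ℕ} {F H : (ℕ → α) → ℝ} (h : ∀ c, F c ≤ H c) : avg n F ≤ avg n H := by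
  induction n generalizing F H with
  | zero => exact h _
  | succ n ih =>
    exact div_le_div_of_nonneg_right (Finset.sum_le_sum fun a _ => ih fun c => h _)
      (by positivity)

/-- Disjoint blocks of a sequence are independent. -/
lemma avg_mul_shift {i : ℕ} (n : ℕ) {F : (ℕ → α) → ℝ} (hF : DependsOn F (Set.Iio i))
    (H : (ℕ → α) → ℝ) :
    avg (i + n) (fun c => F c * H fun j => c (i + j)) = avg i F * avg n H := by
  induction i generalizing F with
  | zero =>
    have : ∀ c, F c = F fun _ => default := fun c => hF (by simp)
    simp only [Nat.zero_add, avg]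
    rw [← avg_const_mul]
    congr 1
    funext c
    rw [this c]
  | succ i ih =>
    rw [Nat.add_right_comm, avg, avg, div_mul_eq_mul_div, Finset.sum_mul]
    congr 1
    refine Finset.sum_congr rfl fun a _ => ?_
    have hd : DependsOn (fun c => F (consSeq a c)) (Set.Iio i) := by
      intro c d h
      refine hF fun j hj => ?_
      cases j with
      | zero => rfl
      | succ j => exact h j (by simpa using hj)
    rw [← ih hd]
    congr 1
    funext c
    congr 2
    funext j
    rw [Nat.add_right_comm, consSeq_succ]

lemma avg_of_dependsOn {i : ℕ} (n : ℕ) {F : (ℕ → α) → ℝ} (hF : DependsOn F (Set.Iio i)) :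
    avg (i + n) F = avg i F := by
  simpa [avg_const] using avg_mul_shift n hF (fun _ => 1)

lemma avg_shift (i n : ℕ) (H : (ℕ → α) → ℝ) :
    avg (i + n) (fun c => H fun j => c (i + j)) = avg n H := by
  have h : DependsOn (fun _ : ℕ → α => (1 : ℝ)) (Set.Iio i) := fun _ _ _ => rfl
  simpa [avg_const] using avg_mul_shift n h H

lemma avg_eq_sum (n : ℕ) (F : (ℕ → α) → ℝ) :
    avg n F = ∑ c : Fin n → α, (1 / (Fintype.card α : ℝ)) ^ n * F (extendSeq c) := by
  induction n generalizing F with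
  | zero =>
    simp only [avg, pow_zero, one_mul, Finset.univ_unique, Finset.sum_singleton]
    congr 1
  | succ n ih =>
    rw [avg, ← (Fin.consEquiv fun _ => α).sum_comp, Fintype.sum_prod_type, Finset.sum_div]
    refine Finset.sum_congr rfl fun a _ => ?_
    rw [ih, Finset.sum_div]
    refine Finset.sum_congr rfl fun c _ => ?_
    simp only [Fin.consEquiv, Equiv.coe_fn_mk]
    rw [extendSeq_cons, pow_succ]
    ring

end Average

/-! ### Left and right survival probabilities and the greedy frequency -/

section Levels

open Classical in
/-- The indicator of a proposition. -/
noncomputable def ind (p : Prop) : ℝ := if p then 1 else 0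

lemma ind_true : ind True = 1 := if_pos trivial

lemma ind_nonneg (p : Prop) : 0 ≤ ind p := by unfold ind; split_ifs <;> norm_num

lemma ind_le_one (p : Prop) : ind p ≤ 1 := by unfold ind; split_ifs <;> norm_num

lemma ind_not (p : Prop) : ind (¬ p) = 1 - ind p := by
  by_cases h : p <;> simp [ind, h]

lemma ind_and (p q : Prop) : ind (p ∧ q) = ind p * ind q := by
  by_cases h : p <;> by_cases h' : q <;> simp [ind, h, h']

variable {K : ℕ}

/-- User `i` is not matched to its left by the edges of level at least `k`. -/
def leftFree (c : ℕ → Fin K) : ℕ → Fin K → Prop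
  | 0, _ => True
  | i + 1, k => ¬ (k ≤ c i ∧ leftFree c i (c i))

/-- The first user of a path with `d` edges is not matched by the edges of level larger
than `k`. -/
def rightFree : ℕ → (ℕ → Fin K) → Fin K → Prop
  | 0, _, _ => True
  | d + 1, c, k => ¬ (k < c 0 ∧ rightFree d (fun j => c (j + 1)) (c 0))

/-- The edge `i` is selected by the greedy algorithm on the path with `n` edges of levels `c`. -/
def Selected (n : ℕ) (c : ℕ → Fin K) (i : ℕ) : Prop :=
  leftFree c i (c i) ∧ rightFree (n - (i + 1)) (fun j => c (i + 1 + j)) (c i)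

lemma leftFree_congr {i : ℕ} {c d : ℕ → Fin K} (h : ∀ j < i, c j = d j) (k : Fin K) :
    leftFree c i k ↔ leftFree d i k := by
  induction i generalizing k with
  | zero => rfl
  | succ i ih =>
    rw [leftFree, leftFree, h i (Nat.lt_succ_self i),
      ih (fun j hj => h j (hj.trans (Nat.lt_succ_self i)))]

lemma dependsOn_leftFree (i : ℕ) (k : Fin K) :
    DependsOn (fun c => ind (leftFree c i k)) (Set.Iio i) := by
  intro c d h
  simp only [leftFree_congr (fun j hj => h j hj) k]

lemma sum_ind_eq_mul (k : Fin K) (f : Fin K → ℝ) : ∑ l, ind (k = l) * f l = f k := by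
  simp [ind]

lemma sum_ind_eq (k : Fin K) : ∑ l, ind (l = k) = 1 := by
  simpa [eq_comm] using sum_ind_eq_mul k fun _ => 1

lemma sum_lt_eq_sum_le_sub (k : Fin K) (f : Fin K → ℝ) :
    ∑ l, (if k < l then f l else 0) = ∑ l, (if k ≤ l then f l else 0) - f k := by
  rw [eq_sub_iff_add_eq]
  have : f k = ∑ l, if l = k then f l else 0 := by simp
  rw [this, ← Finset.sum_add_distrib]
  refine Finset.sum_congr rfl fun l _ => ?_
  rcases lt_trichotomy k l with h | h | h
  · simp [h, h.le, h.ne']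
  · simp [h]
  · simp [h.not_gt, h.not_ge, h.ne]

/-- The limit mean of `leftProb`. -/
noncomputable def leftLim (k : Fin K) : ℝ := ((K : ℝ) / (K + 1)) ^ (K - (k : ℕ))

/-- The limit of `rightProb`. -/
noncomputable def rightLim (k : Fin K) : ℝ := (((K : ℝ) - 1) / K) ^ (K - ((k : ℕ) + 1))

variable [NeZero K]

/-- The probability that user `i` is not matched to its left by edges of level at least `k`. -/
noncomputable def leftProb (i : ℕ) (k : Fin K) : ℝ := avg i fun c => ind (leftFree c i k)

/-- The probability that the first user of a path with `d` edges is not matched by edges of level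
larger than `k`. -/
noncomputable def rightProb (d : ℕ) (k : Fin K) : ℝ := avg d fun c => ind (rightFree d c k)

lemma leftProb_nonneg (i : ℕ) (k : Fin K) : 0 ≤ leftProb i k := by
  simpa [avg_const, leftProb] using avg_mono (n := i) fun c : ℕ → Fin K => ind_nonneg (leftFree c i k)

lemma leftProb_le_one (i : ℕ) (k : Fin K) : leftProb i k ≤ 1 := by
  simpa [avg_const, leftProb] using avg_mono (n := i) fun c : ℕ → Fin K => ind_le_one (leftFree c i k)

lemma rightProb_nonneg (i : ℕ) (k : Fin K) : 0 ≤ rightProb i k := by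
  simpa [avg_const, rightProb] using avg_mono (n := i) fun c : ℕ → Fin K => ind_nonneg (rightFree i c k)

lemma rightProb_le_one (i : ℕ) (k : Fin K) : rightProb i k ≤ 1 := by
  simpa [avg_const, rightProb] using avg_mono (n := i) fun c : ℕ → Fin K => ind_le_one (rightFree i c k)

lemma leftProb_zero (k : Fin K) : leftProb 0 k = 1 := by
  simp [leftProb, avg, leftFree, ind_true]

lemma avg_one_ind (k : Fin K) : avg 1 (fun c : ℕ → Fin K => ind (c 0 = k)) = 1 / K := by
  simp [avg, sum_ind_eq]

lemma leftProb_succ (i : ℕ) (k : Fin K) :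
    leftProb (i + 1) k = 1 - (∑ l, if k ≤ l then leftProb i l else 0) / K := by
  have e : ∀ c : ℕ → Fin K, ind (leftFree c (i + 1) k) =
      1 - ∑ l, ind (k ≤ l) * (ind (leftFree c i l) * ind (c (i + 0) = l)) := by
    intro c
    rw [leftFree, ind_not, ind_and]
    congr 1
    rw [← sum_ind_eq_mul (c i) (fun l => ind (k ≤ l) * ind (leftFree c i l))]
    exact Finset.sum_congr rfl fun l _ => by rw [Nat.add_zero]; ring
  rw [leftProb]
  simp_rw [e]
  rw [avg_sub, avg_const, avg_sum, Finset.sum_div]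
  congr 1
  refine Finset.sum_congr rfl fun l _ => ?_
  rw [avg_const_mul, avg_mul_shift 1 (dependsOn_leftFree i l) (fun c => ind (c 0 = l)),
    avg_one_ind, leftProb]
  by_cases h : k ≤ l <;> simp [ind, h, div_eq_mul_inv]

lemma rightProb_succ (d : ℕ) (k : Fin K) :
    rightProb (d + 1) k = 1 - (∑ l, if k < l then rightProb d l else 0) / K := by
  rw [rightProb, avg]
  have e : ∀ (a : Fin K) (c : ℕ → Fin K), ind (rightFree (d + 1) (consSeq a c) k) =
      1 - ind (k < a) * ind (rightFree d c a) := by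
    intro a c
    rw [rightFree, ind_not, ind_and]
    rfl
  have hK : (K : ℝ) ≠ 0 := by exact_mod_cast NeZero.ne K
  simp_rw [e, avg_sub, avg_const, avg_const_mul]
  rw [Finset.sum_sub_distrib, sub_div, Fintype.card_fin]
  congr 1
  · simp [hK]
  · congr 1
    refine Finset.sum_congr rfl fun l _ => ?_
    by_cases h : k < l <;> simp [ind, h, rightProb]

/-- Conditioning on the level `k` of edge `i`, of probability `1 / K`, leaves two independent events
on the edges to its left and to its right. -/
lemma avg_selected {n i : ℕ} (hi : i < n) (v : Fin K → ℝ) :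
    avg n (fun c => ind (Selected n c i) * v (c i)) =
      ∑ k, v k * (leftProb i k * (rightProb (n - (i + 1)) k / K)) := by
  obtain ⟨d, rfl⟩ : ∃ d, n = i + (d + 1) := ⟨n - (i + 1), by omega⟩
  have hd : i + (d + 1) - (i + 1) = d := by omega
  have e : ∀ c : ℕ → Fin K, ind (Selected (i + (d + 1)) c i) * v (c i) =
      ∑ k, v k * (ind (leftFree c i k) *
        (ind (c (i + 0) = k) * ind (rightFree d (fun j => c (i + (j + 1))) k))) := by
    intro c
    rw [Selected, ind_and, hd]
    have := sum_ind_eq_mul (c i) (fun k => ind (leftFree c i k) *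
      ind (rightFree d (fun j => c (i + (j + 1))) k) * v k)
    have e2 : (fun j => c (i + 1 + j)) = fun j => c (i + (j + 1)) := by
      funext j; congr 1; omega
    rw [e2, ← this]
    exact Finset.sum_congr rfl fun k _ => by rw [Nat.add_zero]; ring
  simp_rw [e]
  rw [avg_sum, hd]
  refine Finset.sum_congr rfl fun k _ => ?_
  rw [avg_const_mul, avg_mul_shift (d + 1) (dependsOn_leftFree i k)
    (fun c => ind (c 0 = k) * ind (rightFree d (fun j => c (j + 1)) k)), leftProb]
  congr 2
  have e3 : ∀ a c, ind (consSeq a c 0 = k) * ind (rightFree d (fun j => consSeq a c (j + 1)) k)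
      = ind (a = k) * ind (rightFree d c k) := fun a c => rfl
  simp only [avg, e3, avg_const_mul, Fintype.card_fin]
  rw [← Finset.sum_mul]
  rw [sum_ind_eq, one_mul, rightProb]

lemma one_le_cast : (1 : ℝ) ≤ K := by exact_mod_cast NeZero.one_le

lemma leftLim_eq (k : Fin K) : leftLim k = 1 - (∑ l, if k ≤ l then leftLim l else 0) / K := by
  have hK := one_le_cast (K := K)
  rw [Finset.sum_div]
  have := sum_tail_telescope (fun i => 1 - ((K : ℝ) / (K + 1)) ^ (K - i)) (by simp) k
  rw [Finset.sum_congr rfl fun l _ => ?_, this, sub_sub_cancel, leftLim]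
  split_ifs
  · obtain ⟨j, hj⟩ : ∃ j, K - ((l : ℕ) + 1) = j := ⟨_, rfl⟩
    have hj' : K - (l : ℕ) = j + 1 := by have := l.2; omega
    rw [leftLim, hj, hj', pow_succ]
    field_simp
    ring
  · simp

lemma rightLim_eq (k : Fin K) :
    rightLim k = 1 - (∑ l, if k < l then rightLim l else 0) / K := by
  have hK := one_le_cast (K := K)
  have e : ∀ l : Fin K, rightLim l / K = (1 - (((K : ℝ) - 1) / K) ^ (K - (l : ℕ))) -
      (1 - (((K : ℝ) - 1) / K) ^ (K - ((l : ℕ) + 1))) := by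
    intro l
    obtain ⟨j, hj⟩ : ∃ j, K - ((l : ℕ) + 1) = j := ⟨_, rfl⟩
    have hj' : K - (l : ℕ) = j + 1 := by have := l.2; omega
    rw [rightLim, hj, hj', pow_succ]
    field_simp
    ring
  have := sum_tail_telescope (fun i => 1 - (((K : ℝ) - 1) / K) ^ (K - i)) (by simp) k
  simp only [← e] at this
  rw [sum_lt_eq_sum_le_sub, sub_div, e, Finset.sum_div]
  simp only [ite_div, zero_div]
  rw [this, rightLim]
  ring

/-- The recursion refers only to strictly higher levels, so it becomes stationary once `d` reaches
the number of levels above `k`. -/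
lemma rightProb_eq {d : ℕ} {k : Fin K} (h : K ≤ k + 1 + d) : rightProb d k = rightLim k := by
  induction d generalizing k with
  | zero =>
    have : K - ((k : ℕ) + 1) = 0 := by omega
    simp [rightProb, avg, rightFree, ind_true, rightLim, this]
  | succ d ih =>
    rw [rightProb_succ, rightLim_eq]
    congr 2
    refine Finset.sum_congr rfl fun l _ => ?_
    split_ifs with hl
    · exact ih (by have := Fin.lt_def.1 hl; omega)
    · rfl

/-- Here the recursion involves level `k` itself and is not stationary after finitely many steps.
Summing it over `i` telescopes and bounds the accumulated error by downward induction on `k`,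
without a rate of convergence. -/
lemma abs_sum_leftProb_sub_le (n : ℕ) (k : Fin K) :
    |∑ i ∈ Finset.range n, (leftProb i k - leftLim k)| ≤ K := by
  have hK := one_le_cast (K := K)
  induction k using WellFoundedGT.induction with
  | ind k ih =>
  set S : Fin K → ℝ := fun l => ∑ i ∈ Finset.range n, (leftProb i l - leftLim l) with hS
  have h1 : S k + (leftProb n k - leftLim k) =
      (1 - leftLim k) - (∑ l, if k ≤ l then S l else 0) / K := by
    rw [hS]
    dsimp only
    rw [← Finset.sum_range_succ, Finset.sum_range_succ', leftProb_zero, add_comm]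
    rw [sub_eq_add_neg (1 - leftLim k)]
    congr 1
    have : ∀ i, leftProb (i + 1) k - leftLim k =
        -((∑ l, if k ≤ l then (leftProb i l - leftLim l) else 0) / K) := by
      intro i
      rw [leftProb_succ, leftLim_eq, sub_sub_sub_cancel_left, ← sub_div, ← neg_div,
        ← Finset.sum_sub_distrib, ← Finset.sum_neg_distrib]
      congr 1
      exact Finset.sum_congr rfl fun l _ => by split_ifs <;> simp
    simp_rw [this]
    rw [Finset.sum_neg_distrib, ← Finset.sum_div, Finset.sum_comm]
    congr 2
    refine Finset.sum_congr rfl fun l _ => ?_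
    split_ifs <;> simp
  have h2 := sum_lt_eq_sum_le_sub k S
  -- The term `l = k` moves to the left. On the right, the first part lies in `[0, 1]` and the
  -- second, having at most `K - 1` summands bounded by `K`, is at most `K - 1`.
  have h3 : S k * (1 + 1 / K) = (1 - leftProb n k) - (∑ l, if k < l then S l else 0) / K := by
    rw [h2, sub_div]; linarith [show S k * (1 + 1 / K) = S k + S k / K by ring]
  have h4 : |∑ l, if k < l then S l else 0| ≤ (K - 1) * K := by
    refine (Finset.abs_sum_le_sum_abs _ _).trans ?_
    have : ∀ l, |if k < l then S l else 0| ≤ if l = k then 0 else (K : ℝ) := by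
      intro l
      by_cases hl : k < l
      · rw [if_pos hl, if_neg hl.ne']
        exact ih l hl
      · simp only [hl, if_false, abs_zero]
        split_ifs <;> linarith
    refine (Finset.sum_le_sum fun l _ => this l).trans (le_of_eq ?_)
    have : ∀ l : Fin K, (if l = k then 0 else (K : ℝ)) = K - if l = k then (K : ℝ) else 0 := by
      intro l; split_ifs <;> simp
    simp_rw [this]
    rw [Finset.sum_sub_distrib]
    simp
    ring
  have h5 := leftProb_nonneg n k
  have h6 := leftProb_le_one n k
  have h7 : |S k * (1 + 1 / K)| ≤ K := by
    rw [h3]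
    have : |(∑ l, if k < l then S l else 0) / K| ≤ K - 1 := by
      rw [abs_div, abs_of_pos (by linarith : (0 : ℝ) < K)]
      exact (div_le_iff₀ (by linarith)).2 h4
    rw [abs_le] at this ⊢
    constructor <;> linarith [this.1, this.2]
  rw [abs_mul, abs_of_pos (by positivity : (0 : ℝ) < 1 + 1 / K)] at h7
  refine le_trans ?_ h7
  exact le_mul_of_one_le_right (abs_nonneg _) (by simp)

lemma leftLim_mul_rightLim (k : Fin K) : leftLim k * (rightLim k / K) = greedyFreq K k := by
  have hK := one_le_cast (K := K)
  obtain ⟨j, hj⟩ : ∃ j, K - ((k : ℕ) + 1) = j := ⟨_, rfl⟩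
  have hj' : K - (k : ℕ) = j + 1 := by have := k.2; omega
  rw [leftLim, rightLim, greedyFreq, hj, hj', div_pow, div_pow]
  field_simp
  ring

lemma rightLim_nonneg (k : Fin K) : 0 ≤ rightLim k := by
  rw [← rightProb_eq (d := K) (by omega)]; exact rightProb_nonneg _ _

lemma rightLim_le_one (k : Fin K) : rightLim k ≤ 1 := by
  rw [← rightProb_eq (d := K) (by omega)]; exact rightProb_le_one _ _

/-- One `K` pays for the left factors; the other for the at most `K` edges near the right end where
`rightProb` may differ from its limit. -/
lemma abs_sum_leftProb_mul_rightProb_sub_le (n : ℕ) (k : Fin K) :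
    |∑ i ∈ Finset.range n, leftProb i k * rightProb (n - (i + 1)) k -
      n * (leftLim k * rightLim k)| ≤ 2 * K := by
  have hK := one_le_cast (K := K)
  have e : ∑ i ∈ Finset.range n, leftProb i k * rightProb (n - (i + 1)) k -
      n * (leftLim k * rightLim k) =
      (∑ i ∈ Finset.range n, (leftProb i k - leftLim k)) * rightLim k +
      ∑ i ∈ Finset.range n, leftProb i k * (rightProb (n - (i + 1)) k - rightLim k) := by
    simp only [Finset.sum_sub_distrib, mul_sub, sub_mul, ← Finset.sum_mul, Finset.sum_const,
      Finset.card_range, nsmul_eq_mul]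
    ring
  rw [e, two_mul]
  refine (abs_add_le _ _).trans (add_le_add ?_ ?_)
  · rw [abs_mul, abs_of_nonneg (rightLim_nonneg k)]
    exact (mul_le_of_le_one_right (abs_nonneg _) (rightLim_le_one k)).trans
      (abs_sum_leftProb_sub_le n k)
  · refine (Finset.abs_sum_le_sum_abs _ _).trans ?_
    have : ∀ i ∈ Finset.range n, |leftProb i k * (rightProb (n - (i + 1)) k - rightLim k)| ≤
        if n - 1 - i < K then 1 else 0 := by
      intro i _
      have hi : n - (i + 1) = n - 1 - i := by omega
      rw [hi]
      split_ifs with h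
      · rw [abs_mul, abs_of_nonneg (leftProb_nonneg i k)]
        refine mul_le_one₀ (leftProb_le_one i k) (abs_nonneg _) (abs_le.2 ⟨?_, ?_⟩)
        · linarith [rightProb_nonneg (n - 1 - i) k, rightLim_le_one k]
        · linarith [rightProb_le_one (n - 1 - i) k, rightLim_nonneg k]
      · rw [rightProb_eq (by omega)]; simp
    refine (Finset.sum_le_sum this).trans ?_
    rw [Finset.sum_range_reflect (fun i => if i < K then (1 : ℝ) else 0) n, ← Finset.sum_filter,
      Finset.sum_const, nsmul_eq_mul, mul_one]
    have : Finset.filter (· < K) (Finset.range n) ⊆ Finset.range K := fun i hi => by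
      simpa using (Finset.mem_filter.1 hi).2
    exact_mod_cast (Finset.card_le_card this).trans_eq (Finset.card_range K)

lemma abs_avg_sum_selected_sub_le (n : ℕ) (v : Fin K → ℝ) (h0 : ∀ k, 0 ≤ v k) :
    |avg n (fun c => ∑ i ∈ Finset.range n, ind (Selected n c i) * v (c i)) -
      n * ∑ k, v k * greedyFreq K k| ≤ 2 * ∑ k, v k := by
  have hK := one_le_cast (K := K)
  rw [avg_sum, Finset.sum_congr rfl fun i hi => avg_selected (Finset.mem_range.1 hi) v,
    Finset.sum_comm, Finset.mul_sum, ← Finset.sum_sub_distrib, Finset.mul_sum]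
  refine (Finset.abs_sum_le_sum_abs _ _).trans (Finset.sum_le_sum fun k _ => ?_)
  have e : ∑ i ∈ Finset.range n, v k * (leftProb i k * (rightProb (n - (i + 1)) k / K)) -
      n * (v k * greedyFreq K k) = v k / K * (∑ i ∈ Finset.range n,
        leftProb i k * rightProb (n - (i + 1)) k - n * (leftLim k * rightLim k)) := by
    rw [← leftLim_mul_rightLim, mul_sub, Finset.mul_sum]
    congr 1
    · exact Finset.sum_congr rfl fun i _ => by ring
    · ring
  rw [e, abs_mul, abs_of_nonneg (div_nonneg (h0 k) (by linarith))]
  refine (mul_le_mul_of_nonneg_left (abs_sum_leftProb_mul_rightProb_sub_le n k)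
    (div_nonneg (h0 k) (by linarith))).trans_eq ?_
  field_simp

end Levels

/-! ### The optimal matching: upper bound and existence of the limit -/

section Optimum

/-- No two consecutive numbers belong to `S`. -/
def IsSparse (S : Finset ℕ) : Prop := ∀ i ∈ S, i + 1 ∉ S

lemma isSparse_empty : IsSparse ∅ := fun i hi => by simp at hi

open Classical in
/-- The largest weight of a sparse subset of `{0, …, n - 1}`. -/
noncomputable def sparseOpt (n : ℕ) (w : ℕ → ℝ) : ℝ :=
  ((Finset.range n).powerset.filter IsSparse).sup' ⟨∅, by simp [isSparse_empty]⟩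
    fun S => ∑ i ∈ S, w i

lemma le_sparseOpt {n : ℕ} (w : ℕ → ℝ) {S : Finset ℕ} (hS : S ⊆ Finset.range n)
    (h : IsSparse S) : ∑ i ∈ S, w i ≤ sparseOpt n w := by
  classical
  exact Finset.le_sup' (fun S => ∑ i ∈ S, w i) (by simp [hS, h])

lemma exists_eq_sparseOpt (n : ℕ) (w : ℕ → ℝ) :
    ∃ S ⊆ Finset.range n, IsSparse S ∧ sparseOpt n w = ∑ i ∈ S, w i := by
  classical
  obtain ⟨S, hS, h⟩ := Finset.exists_mem_eq_sup'
    (s := (Finset.range n).powerset.filter IsSparse) ⟨∅, by simp [isSparse_empty]⟩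
    fun S => ∑ i ∈ S, w i
  rw [Finset.mem_filter, Finset.mem_powerset] at hS
  exact ⟨S, hS.1, hS.2, h⟩

lemma sparseOpt_congr_le {n : ℕ} {w w' : ℕ → ℝ} (h : ∀ i < n, w i = w' i) :
    sparseOpt n w ≤ sparseOpt n w' := by
  obtain ⟨S, hS, hS', e⟩ := exists_eq_sparseOpt n w
  rw [e, Finset.sum_congr rfl fun i hi => h i (Finset.mem_range.1 (hS hi))]
  exact le_sparseOpt w' hS hS'

/-- Leaving edge `n` unused makes the choices on its two sides compatible. -/
lemma sparseOpt_add_le (n m : ℕ) (w : ℕ → ℝ) :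
    sparseOpt n w + sparseOpt m (fun j => w (n + 1 + j)) ≤ sparseOpt (n + 1 + m) w := by
  obtain ⟨S, hS, hS', e⟩ := exists_eq_sparseOpt n w
  obtain ⟨T, hT, hT', e'⟩ := exists_eq_sparseOpt m fun j => w (n + 1 + j)
  have hSn : ∀ i ∈ S, i < n := fun i hi => Finset.mem_range.1 (hS hi)
  have hTm : ∀ i ∈ T, i < m := fun i hi => Finset.mem_range.1 (hT hi)
  have hdisj : Disjoint S (T.map (addLeftEmbedding (n + 1))) := by
    rw [Finset.disjoint_left]
    intro i hi hi'
    simp only [Finset.mem_map, addLeftEmbedding_apply] at hi'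
    obtain ⟨j, -, rfl⟩ := hi'
    have := hSn _ hi
    omega
  have : ∑ i ∈ S ∪ T.map (addLeftEmbedding (n + 1)), w i = sparseOpt n w +
      sparseOpt m (fun j => w (n + 1 + j)) := by
    rw [Finset.sum_union hdisj, Finset.sum_map, e, e']
    rfl
  rw [← this]
  refine le_sparseOpt w ?_ ?_
  · intro i hi
    simp only [Finset.mem_union, Finset.mem_map, addLeftEmbedding_apply] at hi
    rw [Finset.mem_range]
    rcases hi with hi | ⟨j, hj, rfl⟩
    · have := hSn i hi; omega
    · have := hTm j hj; omega
  · intro i hi hi'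
    simp only [Finset.mem_union, Finset.mem_map, addLeftEmbedding_apply] at hi hi'
    rcases hi with hi | ⟨j, hj, rfl⟩
    · rcases hi' with hi' | ⟨l, hl, hl'⟩
      · exact hS' i hi hi'
      · have := hSn i hi; omega
    · rcases hi' with hi' | ⟨l, hl, hl'⟩
      · have := hSn _ hi'; omega
      · obtain rfl : l = j + 1 := by omega
        exact hT' j hj hl

variable {K : ℕ}

/-- The indicator that user `i` is matched to its left, when the edges of level at least `k` are
matched greedily from left to right. -/
noncomputable def sweep (c : ℕ → Fin K) (k : Fin K) : ℕ → ℝ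
  | 0 => 0
  | i + 1 => ind (k ≤ c i) * (1 - sweep c k i)

lemma sweep_mem (c : ℕ → Fin K) (k : Fin K) (i : ℕ) : 0 ≤ sweep c k i ∧ sweep c k i ≤ 1 := by
  induction i with
  | zero => simp [sweep]
  | succ i ih =>
    rw [sweep]
    exact ⟨mul_nonneg (ind_nonneg _) (by linarith),
      mul_le_one₀ (ind_le_one _) (by linarith) (by linarith)⟩

/-- The sweep is optimal even among fractional choices: if the last edge is present, the sweep gains
exactly `1` on the last two edges, the most that `y` can gain there; otherwise `y` gains nothing on
the last edge. -/
lemma sum_le_sum_sweep (c : ℕ → Fin K) (k : Fin K) {y : ℕ → ℝ}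
    (hc : ∀ i, y i ≤ ind (k ≤ c i)) (hy2 : ∀ i, y i + y (i + 1) ≤ 1) (n : ℕ) :
    ∑ i ∈ Finset.range n, y i ≤ ∑ i ∈ Finset.range n, sweep c k (i + 1) := by
  induction n using Nat.twoStepInduction with
  | zero => simp
  | one => simpa [sweep] using hc 0
  | more n ih1 ih2 =>
    by_cases h : k ≤ c (n + 1)
    · have e : sweep c k (n + 1 + 1) = 1 - sweep c k (n + 1) := by
        rw [sweep, ind, if_pos h, one_mul]
      rw [Finset.sum_range_succ, Finset.sum_range_succ, Finset.sum_range_succ _ (n + 1),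
        Finset.sum_range_succ _ n, e]
      have := hy2 n
      linarith
    · have h1 := hc (n + 1)
      rw [ind, if_neg h] at h1
      rw [Finset.sum_range_succ, Finset.sum_range_succ _ (n + 1)]
      have := (sweep_mem c k (n + 1 + 1)).1
      linarith

lemma sum_ind_le_sum_sweep (c : ℕ → Fin K) (k : Fin K) {n : ℕ} {S : Finset ℕ}
    (hS : S ⊆ Finset.range n) (h : IsSparse S) :
    ∑ i ∈ S, ind (k ≤ c i) ≤ ∑ i ∈ Finset.range n, sweep c k (i + 1) := by
  have := sum_le_sum_sweep c k (y := fun i => ind (i ∈ S) * ind (k ≤ c i))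
    (fun i => mul_le_of_le_one_left (ind_nonneg _) (ind_le_one _)) (fun i => ?_) n
  · refine le_trans (le_of_eq ?_) this
    rw [← Finset.sum_subset hS (f := fun i => ind (i ∈ S) * ind (k ≤ c i))]
    · exact Finset.sum_congr rfl fun i hi => by simp [ind, hi]
    · intro i _ hi
      simp [ind, hi]
  · have h1 := ind_le_one (k ≤ c i)
    have h2 := ind_le_one (k ≤ c (i + 1))
    by_cases hi : i ∈ S
    · have e : ind (i ∈ S) = 1 := if_pos hi
      have e' : ind (i + 1 ∈ S) = 0 := if_neg (h i hi)
      simpa [e, e'] using h1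
    · have e : ind (i ∈ S) = 0 := if_neg hi
      have := ind_le_one (i + 1 ∈ S)
      simp only [e, zero_mul, zero_add]
      exact mul_le_one₀ this (ind_nonneg _) h2

lemma sweep_congr {i : ℕ} {c d : ℕ → Fin K} (h : ∀ j < i, c j = d j) (k : Fin K) :
    sweep c k i = sweep d k i := by
  induction i with
  | zero => rfl
  | succ i ih =>
    rw [sweep, sweep, h i (Nat.lt_succ_self i),
      ih (fun j hj => h j (hj.trans (Nat.lt_succ_self i)))]

lemma dependsOn_sweep (i : ℕ) (k : Fin K) :
    DependsOn (fun c => sweep c k i) (Set.Iio i) :=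
  fun _ _ h => sweep_congr (fun j hj => h j hj) k

lemma dependsOn_sparseOpt (n : ℕ) (v : Fin K → ℝ) :
    DependsOn (fun c : ℕ → Fin K => sparseOpt n fun i => v (c i)) (Set.Iio n) := by
  intro c d h
  exact le_antisymm (sparseOpt_congr_le fun i hi => by rw [h i hi])
    (sparseOpt_congr_le fun i hi => by rw [h i hi])

lemma sum_le_ind (k : Fin K) : ∑ l, ind (k ≤ l) = (K : ℝ) - k := by
  have h := sum_tail_telescope (fun i => (K : ℝ) - i) (by simp) k
  rw [← h]
  refine Finset.sum_congr rfl fun l _ => ?_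
  unfold ind
  split_ifs
  · push_cast; ring
  · rfl

variable [NeZero K]

lemma avg_sweep_succ (i : ℕ) (k : Fin K) :
    avg (i + 1) (fun c => sweep c k (i + 1)) =
      ((K : ℝ) - k) / K * (1 - avg i fun c => sweep c k i) := by
  have hd : DependsOn (fun c => 1 - sweep c k i) (Set.Iio i) := by
    intro c d h
    have := dependsOn_sweep i k h
    dsimp only at this ⊢
    rw [this]
  have := avg_mul_shift 1 hd fun c => ind (k ≤ c 0)
  rw [avg_sub, avg_const] at this
  simp only [sweep]
  simp_rw [mul_comm (ind _)]
  refine this.trans ?_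
  rw [mul_comm]
  congr 1
  simp only [avg, consSeq_zero, sum_le_ind, Fintype.card_fin]

/-- With `p = (K - k) / K` the means satisfy `m (i + 1) = p * (1 - m i)`, whose fixed point is `p /
(1 + p)`. Summing the recursion leaves the single boundary term `m n ≤ 1`, hence `n + 1`. -/
lemma sum_avg_sweep_le (n : ℕ) (k : Fin K) :
    ∑ i ∈ Finset.range n, avg n (fun c => sweep c k (i + 1)) ≤
      ((K : ℝ) - k) / (2 * K - k) * (n + 1) := by
  have hK := one_le_cast (K := K)
  have hk : ((k : ℕ) : ℝ) + 1 ≤ K := by exact_mod_cast k.2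
  have e1 : ∀ i ∈ Finset.range n, avg n (fun c => sweep c k (i + 1)) =
      avg (i + 1) (fun c => sweep c k (i + 1)) := by
    intro i hi
    rw [Finset.mem_range] at hi
    obtain ⟨d, rfl⟩ : ∃ d, n = i + 1 + d := ⟨n - (i + 1), by omega⟩
    exact avg_of_dependsOn d (dependsOn_sweep (i + 1) k)
  rw [Finset.sum_congr rfl e1]
  set m : ℕ → ℝ := fun i => avg i fun c : ℕ → Fin K => sweep c k i with hm
  have hm1 : m n ≤ 1 := by
    simpa [avg_const] using avg_mono (n := n) fun c : ℕ → Fin K => (sweep_mem c k n).2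
  have hm0 : m 0 = 0 := by simp [hm, avg, sweep]
  have e2 : ∑ i ∈ Finset.range n, m (i + 1) =
      ((K : ℝ) - k) / K * (n - ∑ i ∈ Finset.range n, m i) := by
    rw [Finset.sum_congr rfl fun i _ => avg_sweep_succ i k, ← Finset.mul_sum,
      Finset.sum_sub_distrib]
    simp [hm]
  have e3 : ∑ i ∈ Finset.range n, m (i + 1) + m 0 = ∑ i ∈ Finset.range n, m i + m n := by
    rw [← Finset.sum_range_succ', Finset.sum_range_succ]
  rw [hm0, add_zero] at e3
  change ∑ i ∈ Finset.range n, m (i + 1) ≤ _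
  have h2 : (0 : ℝ) < 2 * K - k := by linarith
  rw [div_mul_eq_mul_div, le_div_iff₀ h2]
  have e4 : ∑ i ∈ Finset.range n, m i = ∑ i ∈ Finset.range n, m (i + 1) - m n := by linarith
  rw [e4, div_mul_eq_mul_div, eq_div_iff (by linarith)] at e2
  nlinarith

lemma avg_sparseOpt_le {v : Fin K → ℝ} (hv : Monotone v) (h0 : ∀ k, 0 ≤ v k) (n : ℕ) :
    avg n (fun c => sparseOpt n fun i => v (c i)) ≤ (n + 1) * ∑ k, v k * matchFreq K k := by
  obtain ⟨D, hD, h⟩ := exists_increments v hv h0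
  have hle : ∀ c : ℕ → Fin K, sparseOpt n (fun i => v (c i)) ≤
      ∑ k, D k * ∑ i ∈ Finset.range n, sweep c k (i + 1) := by
    intro c
    obtain ⟨S, hS, hS', e⟩ := exists_eq_sparseOpt n fun i => v (c i)
    have : ∀ i, v (c i) = ∑ k, D k * ind (k ≤ c i) := by
      intro i
      rw [h]
      refine Finset.sum_congr rfl fun k _ => ?_
      unfold ind
      split_ifs <;> simp
    simp_rw [e, this]
    rw [Finset.sum_comm]
    refine Finset.sum_le_sum fun k _ => ?_
    rw [← Finset.mul_sum]
    exact mul_le_mul_of_nonneg_left (sum_ind_le_sum_sweep c k hS hS') (hD k)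
  refine (avg_mono hle).trans ?_
  rw [avg_sum, sum_mul_eq_sum_increments h, Finset.mul_sum]
  refine Finset.sum_le_sum fun k _ => ?_
  rw [avg_const_mul, avg_sum, matchFreq_tail, mul_left_comm]
  refine mul_le_mul_of_nonneg_left ((sum_avg_sweep_le n k).trans_eq (mul_comm _ _)) (hD k)

lemma exists_tendsto_avg_sparseOpt (v : Fin K → ℝ) (hv : Monotone v) (h0 : ∀ k, 0 ≤ v k) :
    ∃ U, Tendsto (fun n : ℕ => avg n (fun c => sparseOpt n fun i => v (c i)) / ((n : ℝ) + 1))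
      atTop (𝓝 U) := by
  -- Indexing by the number `N` of users, one more than the number of edges, absorbs the deleted
  -- edge and makes `u` exactly subadditive.
  let u : ℕ → ℝ := fun N => match N with
    | 0 => 0
    | n + 1 => -avg n (fun c => sparseOpt n fun i => v (c i))
  have hu : Subadditive u := by
    intro N M
    cases N with
    | zero => simp [u]
    | succ n =>
      cases M with
      | zero => simp [u]
      | succ m =>
        have e : n + 1 + (m + 1) = n + 1 + m + 1 := by omega
        rw [e]
        have h1 := avg_mono (n := n + 1 + m) fun c : ℕ → Fin K =>
          sparseOpt_add_le n m fun i => v (c i)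
        rw [avg_add, avg_shift (n + 1) m fun c => sparseOpt m fun i => v (c i), Nat.add_assoc,
          avg_of_dependsOn (1 + m) (dependsOn_sparseOpt n v), ← Nat.add_assoc] at h1
        simp only [u]
        linarith
  have hb : BddBelow (Set.range fun n => u n / n) := by
    refine ⟨-∑ k, v k * matchFreq K k, ?_⟩
    rintro _ ⟨N, rfl⟩
    cases N with
    | zero =>
      simp only [u, zero_div, Left.neg_nonpos_iff]
      exact Finset.sum_nonneg fun k _ => mul_nonneg (h0 k) (matchFreq_pos k).le
    | succ n =>
      have := avg_sparseOpt_le hv h0 n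
      simp only [u]
      rw [le_div_iff₀ (by positivity)]
      push_cast
      linarith
  refine ⟨-hu.lim, ?_⟩
  have := ((hu.tendsto_lim hb).comp (tendsto_add_atTop_nat 1)).neg
  refine this.congr fun n => ?_
  simp [u, neg_div]

lemma tendsto_avg_selected (v : Fin K → ℝ) (h0 : ∀ k, 0 ≤ v k) :
    Tendsto (fun n : ℕ => avg n (fun c => ∑ i ∈ Finset.range n, ind (Selected n c i) * v (c i)) /
      ((n : ℝ) + 1)) atTop (𝓝 (∑ k, v k * greedyFreq K k)) := by
  set x := ∑ k, v k * greedyFreq K k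
  have hx : 0 ≤ x := Finset.sum_nonneg fun k _ => mul_nonneg (h0 k) (greedyFreq_nonneg k)
  have hlim : Tendsto (fun n : ℕ => (2 * ∑ k, v k + x) * (1 / ((n : ℝ) + 1))) atTop (𝓝 0) := by
    simpa using tendsto_one_div_add_atTop_nhds_zero_nat.const_mul (2 * ∑ k, v k + x)
  refine tendsto_iff_dist_tendsto_zero.2 (squeeze_zero (fun _ => dist_nonneg) (fun n => ?_) hlim)
  have h := abs_avg_sum_selected_sub_le n v h0
  have hn : (0 : ℝ) < n + 1 := by positivity
  rw [Real.dist_eq, mul_one_div, div_sub' hn.ne', abs_div, abs_of_pos hn]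
  refine div_le_div_of_nonneg_right ?_ hn.le
  rw [abs_le] at h ⊢
  constructor <;> linarith [h.1, h.2]

end Optimum

/-! ### The greedy algorithm as a stable matching, on any graph -/

section Greedy

variable {V : Type*} {G : SimpleGraph V} [LinearOrder V] {w : G.edgeSet → ℝ}

/-- A common user of the adjacent edges `f` and `g` prefers `g` to `f`. -/
def Beats (w : G.edgeSet → ℝ) (g f : G.edgeSet) : Prop :=
  ∃ (u a b : V) (ha : G.Adj u a) (hb : G.Adj u b), f = ⟨s(u, a), ha⟩ ∧ g = ⟨s(u, b), hb⟩ ∧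
    (w f < w g ∨ w f = w g ∧ b < a)

/-- An edge outside `S` cannot receive mutual proposals: at an end `x` some edge `g` of `S` is
preferred, and its other end is still free, since only `g` itself could have matched it within `S`,
and then `x` would be matched too. -/
lemma greedyStep_subset {S M : Set G.edgeSet} (hS : IsMatching G S)
    (hdom : ∀ f ∉ S, ∃ g ∈ S, Beats w g f) (hM : M ⊆ S) : greedyStep G w M ⊆ S := by
  rintro e (he | ⟨u, v, huv, h1, h2⟩)
  · exact hM he
  by_contra heS
  obtain ⟨g, hg, x, a, b, ha, hb, rfl, rfl, hw⟩ := hdom e heS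
  have hp : Proposes G w M x a := by
    rcases Sym2.eq_iff.1 huv with ⟨rfl, rfl⟩ | ⟨rfl, rfl⟩
    · exact h1
    · exact h2
  obtain ⟨hx, _, _, hbest⟩ := hp
  have hb' : Unmatched G M b := by
    intro e' he' hbe'
    have := hS b e' (hM he') _ hg hbe' (Sym2.mem_mk_right x b)
    exact hx e' he' (this ▸ Sym2.mem_mk_left x b)
  rcases hbest b hb hb' with h | ⟨h, h'⟩
  · rcases hw with hw | ⟨hw, -⟩
    · exact lt_asymm h hw
    · exact h.ne hw.symm
  · rcases hw with hw | ⟨-, hw⟩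
    · exact hw.ne h.symm
    · exact absurd h' hw.not_ge

lemma iterate_greedyStep_subset {S : Set G.edgeSet} (hS : IsMatching G S)
    (hdom : ∀ f ∉ S, ∃ g ∈ S, Beats w g f) (t : ℕ) : (greedyStep G w)^[t] ∅ ⊆ S := by
  induction t with
  | zero => simp
  | succ t ih =>
    rw [Function.iterate_succ_apply']
    exact greedyStep_subset hS hdom ih

/-- Suppose an end of `e` preferred another free neighbour. That edge is outside `S`, so it is
beaten by an edge of `S` of still smaller rank, already in `M`, which matches one of its two
supposedly free ends. -/
lemma mem_greedyStep {S M : Set G.edgeSet} (hS : IsMatching G S)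
    (hdom : ∀ f ∉ S, ∃ g ∈ S, Beats w g f) {rank : G.edgeSet → ℕ}
    (hrank : ∀ g f, Beats w g f → rank g < rank f) (hM : M ⊆ S) {e : G.edgeSet} (he : e ∈ S)
    (h : ∀ g ∈ S, rank g < rank e → g ∈ M) : e ∈ greedyStep G w M := by
  by_cases heM : e ∈ M
  · exact Or.inl heM
  have hfree : ∀ u ∈ (e : Sym2 V), Unmatched G M u := fun u hu e' he' hu' =>
    heM (hS u e he e' (hM he') hu hu' ▸ he')
  have hprop : ∀ (u v : V) (huv : G.Adj u v), e = ⟨s(u, v), huv⟩ → Proposes G w M u v := by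
    rintro u v huv rfl
    refine ⟨hfree u (Sym2.mem_mk_left u v), hfree v (Sym2.mem_mk_right u v), huv, ?_⟩
    intro v' h' hv'
    by_contra hcon
    push Not at hcon
    have hbeats : Beats w ⟨s(u, v'), h'⟩ ⟨s(u, v), huv⟩ := by
      refine ⟨u, v, v', huv, h', rfl, rfl, ?_⟩
      rcases hcon.1.lt_or_eq with hlt | heq
      · exact Or.inl hlt
      · exact Or.inr ⟨heq, hcon.2 heq.symm⟩
    have hf : (⟨s(u, v'), h'⟩ : G.edgeSet) ∉ S := by
      intro hf
      have := hS u _ he _ hf (Sym2.mem_mk_left u v) (Sym2.mem_mk_left u v')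
      have hr := hrank _ _ hbeats
      rw [this] at hr
      exact lt_irrefl _ hr
    obtain ⟨g, hg, hgf⟩ := hdom _ hf
    have hgM := h g hg ((hrank _ _ hgf).trans (hrank _ _ hbeats))
    obtain ⟨x, a, b, ha, hb, hfx, rfl, -⟩ := hgf
    have hx : x ∈ s(u, v') := by
      rw [show s(u, v') = s(x, a) from congrArg Subtype.val hfx]
      exact Sym2.mem_mk_left x a
    have hfx : Unmatched G M x := by
      rcases Sym2.mem_iff.1 hx with rfl | rfl
      · exact hfree x (Sym2.mem_mk_left x v)
      · exact hv'
    exact hfx _ hgM (Sym2.mem_mk_left x b)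
  obtain ⟨e, he'⟩ := e
  induction e using Sym2.ind with
  | _ u v =>
    exact Or.inr ⟨u, v, rfl, hprop u v he' rfl, hprop v u (SimpleGraph.Adj.symm he') (Subtype.ext Sym2.eq_swap)⟩

/-- A matching that dominates every other edge in an acyclic preference system is the output of
the greedy algorithm. -/
theorem greedyMatching_eq {S : Set G.edgeSet} (hS : IsMatching G S)
    (hdom : ∀ f ∉ S, ∃ g ∈ S, Beats w g f) {rank : G.edgeSet → ℕ}
    (hrank : ∀ g f, Beats w g f → rank g < rank f) : greedyMatching G w = S := by
  refine subset_antisymm (Set.iUnion_subset fun t => iterate_greedyStep_subset hS hdom t) ?_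
  have key : ∀ t, ∀ e ∈ S, rank e < t → e ∈ (greedyStep G w)^[t] ∅ := by
    intro t
    induction t with
    | zero => intro e _ h; exact absurd h (Nat.not_lt_zero _)
    | succ t ih =>
      intro e he h
      rw [Function.iterate_succ_apply']
      exact mem_greedyStep hS hdom hrank (iterate_greedyStep_subset hS hdom t) he
        fun g hg hlt => ih g hg (by omega)
  exact fun e he => Set.mem_iUnion.2 ⟨_, key _ e he (Nat.lt_succ_self _)⟩

end Greedy

/-! ### Paths: identification of both matchings, and the limit -/

section Path

open SimpleGraph

lemma pathGraph_adj_castSucc_succ {n : ℕ} (i : Fin n) :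
    (pathGraph (n + 1)).Adj i.castSucc i.succ := pathGraph_adj.2 (Or.inl (by simp))

lemma bijective_pathEdge (n : ℕ) : Function.Bijective fun i : Fin n =>
    (⟨s(i.castSucc, i.succ), pathGraph_adj_castSucc_succ i⟩ : (pathGraph (n + 1)).edgeSet) := by
  constructor
  · intro i j h
    rcases Sym2.eq_iff.1 (congrArg Subtype.val h) with ⟨h, -⟩ | ⟨h, h'⟩
    · exact Fin.castSucc_injective _ h
    · have h1 := congrArg Fin.val h
      have h2 := congrArg Fin.val h'
      simp only [Fin.val_castSucc, Fin.val_succ] at h1 h2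
      omega
  · rintro ⟨e, he⟩
    induction e using Sym2.ind with
    | _ u v =>
      have hu := u.2
      have hv := v.2
      rcases pathGraph_adj.1 he with h | h
      · dsimp only at h
        exact ⟨⟨u, by omega⟩, Subtype.ext (Sym2.eq_iff.2 (Or.inl ⟨rfl, Fin.ext h⟩))⟩
      · dsimp only at h
        exact ⟨⟨v, by omega⟩, Subtype.ext (Sym2.eq_iff.2 (Or.inr ⟨rfl, Fin.ext h⟩))⟩

/-- The edges of a path, numbered from left to right. -/
noncomputable def pathEdge (n : ℕ) : Fin n ≃ (pathGraph (n + 1)).edgeSet :=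
  Equiv.ofBijective _ (bijective_pathEdge n)

/-- The number of an edge of a path. -/
noncomputable def pathIdx {n : ℕ} (e : (pathGraph (n + 1)).edgeSet) : ℕ := (pathEdge n).symm e

lemma pathIdx_lt {n : ℕ} (e : (pathGraph (n + 1)).edgeSet) : pathIdx e < n :=
  ((pathEdge n).symm e).2

lemma pathIdx_pathEdge {n : ℕ} (i : Fin n) : pathIdx (pathEdge n i) = i := by
  rw [pathIdx, Equiv.symm_apply_apply]

lemma pathIdx_injective {n : ℕ} {e f : (pathGraph (n + 1)).edgeSet} (h : pathIdx e = pathIdx f) :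
    e = f := (pathEdge n).symm.injective (Fin.ext h)

lemma mem_edge_iff {n : ℕ} (e : (pathGraph (n + 1)).edgeSet) (u : Fin (n + 1)) :
    u ∈ (e : Sym2 (Fin (n + 1))) ↔ (u : ℕ) = pathIdx e ∨ (u : ℕ) = pathIdx e + 1 := by
  obtain ⟨i, rfl⟩ := (pathEdge n).surjective e
  rw [pathIdx_pathEdge]
  change u ∈ s(i.castSucc, i.succ) ↔ _
  rw [Sym2.mem_iff, Fin.ext_iff, Fin.ext_iff, Fin.val_castSucc, Fin.val_succ]

lemma pathIdx_mk {n : ℕ} {u a : Fin (n + 1)} (h : (pathGraph (n + 1)).Adj u a) :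
    pathIdx ⟨s(u, a), h⟩ = min (u : ℕ) a := by
  have h1 := (mem_edge_iff ⟨s(u, a), h⟩ u).1 (Sym2.mem_mk_left u a)
  have h2 := (mem_edge_iff ⟨s(u, a), h⟩ a).1 (Sym2.mem_mk_right u a)
  rcases pathGraph_adj.1 h with h | h <;> omega

lemma isMatching_path_iff {n : ℕ} (P : ℕ → Prop) :
    IsMatching (pathGraph (n + 1)) {e | P (pathIdx e)} ↔
      ∀ i, i + 1 < n → P i → ¬ P (i + 1) := by
  constructor
  · intro h i hi h1 h2
    have e1 := pathIdx_pathEdge (⟨i, by omega⟩ : Fin n)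
    have e2 := pathIdx_pathEdge (⟨i + 1, hi⟩ : Fin n)
    have := h ⟨i + 1, by omega⟩ (pathEdge n ⟨i, by omega⟩) (by simpa [e1] using h1)
      (pathEdge n ⟨i + 1, hi⟩) (by simpa [e2] using h2) ((mem_edge_iff _ _).2 (by simp [e1]))
      ((mem_edge_iff _ _).2 (by simp [e2]))
    have := congrArg pathIdx this
    rw [e1, e2] at this
    simp at this
  · intro h u e he f hf hue huf
    have h1 := (mem_edge_iff e u).1 hue
    have h2 := (mem_edge_iff f u).1 huf
    have l1 := pathIdx_lt e
    have l2 := pathIdx_lt f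
    apply pathIdx_injective
    by_contra hne
    rcases lt_or_gt_of_ne hne with hlt | hlt
    · have e1 : pathIdx f = pathIdx e + 1 := by omega
      exact h _ (by omega) he (e1 ▸ hf)
    · have e1 : pathIdx e = pathIdx f + 1 := by omega
      exact h _ (by omega) hf (e1 ▸ he)

lemma totalWeight_path {n : ℕ} (w : ℕ → ℝ) (P : ℕ → Prop) :
    totalWeight (pathGraph (n + 1)) (fun e => w (pathIdx e)) {e | P (pathIdx e)} =
      ∑ i ∈ Finset.range n, ind (P i) * w i := by
  rw [totalWeight, Finset.sum_range]
  refine (Finset.sum_equiv (pathEdge n) (by simp) fun i _ => ?_).symm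
  rw [pathIdx_pathEdge, Set.mem_ofPred_eq, pathIdx_pathEdge]
  by_cases h : P i <;> simp [ind, h]

lemma exists_eq_setOf_pathIdx {n : ℕ} (M : Set (pathGraph (n + 1)).edgeSet) :
    ∃ P : ℕ → Prop, M = {e | P (pathIdx e)} := by
  refine ⟨fun i => ∃ e ∈ M, pathIdx e = i, Set.ext fun e => ⟨fun h => ⟨e, h, rfl⟩, ?_⟩⟩
  rintro ⟨f, hf, h⟩
  exact pathIdx_injective h ▸ hf

lemma sum_ind_mul_le_sparseOpt {n : ℕ} (w : ℕ → ℝ) {P : ℕ → Prop}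
    (h : ∀ i, i + 1 < n → P i → ¬ P (i + 1)) :
    ∑ i ∈ Finset.range n, ind (P i) * w i ≤ sparseOpt n w := by
  classical
  have e : ∑ i ∈ Finset.range n, ind (P i) * w i = ∑ i ∈ (Finset.range n).filter P, w i := by
    rw [Finset.sum_filter]
    refine Finset.sum_congr rfl fun i _ => ?_
    by_cases hi : P i <;> simp [ind, hi]
  rw [e]
  refine le_sparseOpt w (Finset.filter_subset _ _) fun i hi hi' => ?_
  rw [Finset.mem_filter, Finset.mem_range] at hi hi'
  exact h i hi'.1 hi.2 hi'.2

lemma optimalWeight_path (n : ℕ) (w : ℕ → ℝ) :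
    optimalWeight (pathGraph (n + 1)) (fun e => w (pathIdx e)) = sparseOpt n w := by
  refine IsGreatest.csSup_eq ⟨?_, ?_⟩
  · obtain ⟨S, hS, hS', e⟩ := exists_eq_sparseOpt n w
    refine ⟨{e | pathIdx e ∈ S},
      (isMatching_path_iff (· ∈ S)).2 fun i _ hi => hS' i hi, ?_⟩
    rw [totalWeight_path w (· ∈ S), e, ← Finset.sum_subset hS]
    · exact Finset.sum_congr rfl fun i hi => by simp [ind, hi]
    · intro i _ hi
      simp [ind, hi]
  · rintro _ ⟨M, hM, rfl⟩
    obtain ⟨P, rfl⟩ := exists_eq_setOf_pathIdx M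
    rw [totalWeight_path]
    exact sum_ind_mul_le_sparseOpt w ((isMatching_path_iff P).1 hM)

variable {K : ℕ}

/-- Either `c (i + 1) ≤ c i`, and edge `i` blocks edge `i + 1` from the left, or `c i < c (i + 1)`,
and edge `i + 1` blocks edge `i` from the right. -/
lemma not_selected_succ {n : ℕ} {c : ℕ → Fin K} {i : ℕ} (hi : i + 1 < n)
    (h : Selected n c i) : ¬ Selected n c (i + 1) := by
  intro h'
  obtain ⟨d, hd⟩ : ∃ d, n - (i + 1) = d + 1 := ⟨n - (i + 1) - 1, by omega⟩
  have hd' : n - (i + 1 + 1) = d := by omega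
  have e : (fun j => c (i + 1 + (j + 1))) = fun j => c (i + 1 + 1 + j) := by
    funext j; congr 1; omega
  rw [Selected, hd, rightFree, e] at h
  rw [Selected, hd', leftFree] at h'
  rcases le_or_gt (c (i + 1)) (c i) with hle | hlt
  · exact h'.1 ⟨hle, h.1⟩
  · exact h.2 ⟨hlt, h'.2⟩

/-- The failing condition provides half of the selection of the blocking neighbour. The other half,
on the side of edge `i`, is automatic because edge `i` is not preferred there. -/
lemma exists_selected_of_not_selected {n : ℕ} {c : ℕ → Fin K} {i : ℕ} (hi : i < n)
    (h : ¬ Selected n c i) :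
    (∃ j, i = j + 1 ∧ c i ≤ c j ∧ Selected n c j) ∨
      (i + 1 < n ∧ c i < c (i + 1) ∧ Selected n c (i + 1)) := by
  rw [Selected, not_and_or] at h
  rcases h with h | h
  · left
    cases i with
    | zero => exact absurd trivial h
    | succ j =>
      rw [leftFree, not_not] at h
      refine ⟨j, rfl, h.1, h.2, ?_⟩
      obtain ⟨d, hd⟩ : ∃ d, n - (j + 1) = d + 1 := ⟨n - (j + 1) - 1, by omega⟩
      rw [hd, rightFree]
      exact fun h' => absurd h'.1 h.1.not_gt
  · right
    obtain hd | ⟨d, hd⟩ : n - (i + 1) = 0 ∨ ∃ d, n - (i + 1) = d + 1 := by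
      rcases Nat.eq_zero_or_pos (n - (i + 1)) with h0 | h0
      · exact Or.inl h0
      · exact Or.inr ⟨n - (i + 1) - 1, by omega⟩
    · rw [hd] at h
      exact absurd trivial h
    · have hd' : n - (i + 1 + 1) = d := by omega
      have e : (fun j => c (i + 1 + (j + 1))) = fun j => c (i + 1 + 1 + j) := by
        funext j; congr 1; omega
      rw [hd, rightFree, not_not, e] at h
      refine ⟨by omega, h.1, ?_, ?_⟩
      · rw [leftFree]
        exact fun h' => absurd h'.1 (not_le.2 h.1)
      · rw [hd']
        exact h.2

lemma greedyMatching_path {n : ℕ} {v : Fin K → ℝ} (hv : StrictMono v) (c : ℕ → Fin K) :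
    greedyMatching (pathGraph (n + 1)) (fun e => v (c (pathIdx e))) =
      {e | Selected n c (pathIdx e)} := by
  -- Lexicographic order, higher level first and then further left, encoded in one number since
  -- `pathIdx e < n`.
  refine greedyMatching_eq (rank := fun e => (K - c (pathIdx e)) * n + pathIdx e)
    ((isMatching_path_iff (Selected n c)).2 fun i hi h => not_selected_succ hi h) ?_ ?_
  · intro f hf
    obtain ⟨i, rfl⟩ := (pathEdge n).surjective f
    have e1 := pathIdx_pathEdge i
    rw [Set.mem_ofPred_eq, e1] at hf
    rcases exists_selected_of_not_selected i.2 hf with ⟨j, hj, hc, hs⟩ | ⟨hi, hc, hs⟩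
    · have hjn : j < n := by have := i.2; omega
      have e2 := pathIdx_pathEdge (⟨j, hjn⟩ : Fin n)
      have hb : (pathGraph (n + 1)).Adj i.castSucc (Fin.castSucc ⟨j, hjn⟩) :=
        pathGraph_adj.2 (Or.inr (by simp [hj]))
      refine ⟨pathEdge n ⟨j, hjn⟩, by rwa [Set.mem_ofPred_eq, e2], i.castSucc, i.succ,
        Fin.castSucc ⟨j, hjn⟩, pathGraph_adj_castSucc_succ i, hb, rfl,
        pathIdx_injective ?_, ?_⟩
      · rw [pathIdx_mk, e2]
        simp [hj]
      · dsimp only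
        rw [e1, e2]
        rcases (hv.monotone hc).lt_or_eq with h | h
        · exact Or.inl h
        · refine Or.inr ⟨h, Fin.lt_def.2 ?_⟩
          simp only [Fin.val_castSucc, Fin.val_succ]
          omega
    · have e2 := pathIdx_pathEdge (⟨i + 1, hi⟩ : Fin n)
      have hb : (pathGraph (n + 1)).Adj i.succ (Fin.succ ⟨i + 1, hi⟩) :=
        pathGraph_adj.2 (Or.inl (by simp))
      refine ⟨pathEdge n ⟨i + 1, hi⟩, by rwa [Set.mem_ofPred_eq, e2], i.succ, i.castSucc,
        Fin.succ ⟨i + 1, hi⟩, (pathGraph_adj_castSucc_succ i).symm, hb,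
        Subtype.ext Sym2.eq_swap, pathIdx_injective ?_, ?_⟩
      · rw [pathIdx_mk, e2]
        simp
      · dsimp only
        rw [e1, e2]
        exact Or.inl (hv hc)
  · rintro g f ⟨u, a, b, ha, hb, hf, hg, h⟩
    have hfn := pathIdx_lt f
    have hgn := pathIdx_lt g
    have hfi := pathIdx_mk ha
    have hgi := pathIdx_mk hb
    rw [← hf] at hfi
    rw [← hg] at hgi
    dsimp only at h ⊢
    rcases h with h | ⟨h, hba⟩
    · have hlt : c (pathIdx f) < c (pathIdx g) := hv.lt_iff_lt.1 h
      have h1 := Fin.lt_def.1 hlt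
      have h2 := (c (pathIdx g)).2
      have h3 : K - (c (pathIdx g) : ℕ) + 1 ≤ K - (c (pathIdx f) : ℕ) := by omega
      have h4 := Nat.mul_le_mul_right n h3
      rw [Nat.succ_mul] at h4
      omega
    · rw [hv.injective h]
      have := Fin.lt_def.1 hba
      have h1 := pathGraph_adj.1 ha
      have h2 := pathGraph_adj.1 hb
      refine Nat.add_lt_add_left ?_ _
      omega

lemma expectation_path [NeZero K] (n : ℕ) (v : Fin K → ℝ)
    (F : ((pathGraph (n + 1)).edgeSet → ℝ) → ℝ) :
    expectation (pathGraph (n + 1)) (fun _ : Fin K => 1 / (K : ℝ)) v F =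
      avg n fun c => F fun e => v (c (pathIdx e)) := by
  rw [expectation, avg_eq_sum]
  refine (Finset.sum_equiv ((pathEdge n).arrowCongr (Equiv.refl (Fin K))) (by simp)
    fun c _ => ?_).symm
  classical
  rw [Finset.prod_const, Finset.card_univ, Fintype.card_fin, ← Nat.card_eq_fintype_card,
    ← Nat.card_congr (pathEdge n), Nat.card_fin]
  congr 2
  funext e
  rw [extendSeq, dif_pos (pathIdx_lt e)]
  rfl

lemma performanceRatio_path [NeZero K] (n : ℕ) {v : Fin K → ℝ} (hv : StrictMono v) :
    performanceRatio (pathGraph (n + 1)) (fun _ : Fin K => 1 / (K : ℝ)) v =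
      avg n (fun c => ∑ i ∈ Finset.range n, ind (Selected n c i) * v (c i)) /
        avg n (fun c => sparseOpt n fun i => v (c i)) := by
  rw [performanceRatio, expectation_path, expectation_path]
  congr 2
  · funext c
    rw [greedyWeight, greedyMatching_path hv c]
    exact totalWeight_path (fun i => v (c i)) (Selected n c)
  · funext c
    exact optimalWeight_path n fun i => v (c i)

theorem exists_tendsto_performanceRatio [NeZero K] {v : Fin K → ℝ} (hv : StrictMono v)
    (h0 : ∀ k, 0 ≤ v k) (hp : ∃ k, 0 < v k) :
    ∃ L : ℝ, Tendsto (fun n : ℕ =>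
        performanceRatio (pathGraph n) (fun _ : Fin K => 1 / (K : ℝ)) v) atTop (𝓝 L) ∧
      uniformBound K v ≤ L := by
  obtain ⟨U, hU⟩ := exists_tendsto_avg_sparseOpt v hv.monotone h0
  have hN := tendsto_avg_selected v h0
  have hNpos := sum_mul_greedyFreq_pos hv.monotone h0 hp
  -- The greedy output is itself a matching; this makes `U` positive, so the limits may be divided.
  have hNU : ∑ k, v k * greedyFreq K k ≤ U := by
    refine le_of_tendsto_of_tendsto' hN hU fun n => ?_
    refine div_le_div_of_nonneg_right (avg_mono fun c => ?_) (by positivity)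
    exact sum_ind_mul_le_sparseOpt _ fun i hi h => not_selected_succ hi h
  have hUD : U ≤ ∑ k, v k * matchFreq K k := by
    refine le_of_tendsto' hU fun n => ?_
    rw [div_le_iff₀ (by positivity), mul_comm]
    exact avg_sparseOpt_le hv.monotone h0 n
  have hUpos := hNpos.trans_le hNU
  refine ⟨_, (tendsto_add_atTop_iff_nat 1).1 ((hN.div hU hUpos.ne').congr fun n => ?_), ?_⟩
  · rw [performanceRatio_path n hv]
    exact div_div_div_cancel_right₀ (by positivity) _ _
  · rw [uniformBound_eq]
    exact div_le_div_of_nonneg_left hNpos.le hUpos hUD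

end Path

end D2D

theorem mainTheorem1 (K : ℕ) (hK : 1 ≤ K) :
    (∀ v : Fin K → ℝ, StrictMono v → (∀ k, 0 ≤ v k) → (∃ k, 0 < v k) →
      (∃ L : ℝ,
        Tendsto (fun n : ℕ =>
          D2D.performanceRatio (SimpleGraph.pathGraph n) (fun _ : Fin K => 1 / (K : ℝ)) v)
          atTop (𝓝 L) ∧
        D2D.uniformBound K v ≤ L) ∧
      1 - (((K : ℝ) - 1) / ((K : ℝ) + 1)) ^ K ≤ D2D.uniformBound K v) ∧
    1 - Real.exp (-2) ≤ 1 - (((K : ℝ) - 1) / ((K : ℝ) + 1)) ^ K ∧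
    |(1 - Real.exp (-2)) - 0.865| < 0.0005 ∧
    (∀ ε : ℝ, 0 < ε → ∃ δ : ℝ, 0 < δ ∧ ∀ v : Fin K → ℝ, StrictMono v →
      0 < v ⟨0, hK⟩ → v ⟨K - 1, Nat.sub_lt hK Nat.one_pos⟩ / v ⟨0, hK⟩ < 1 + δ →
      |D2D.uniformBound K v - (1 - (((K : ℝ) - 1) / ((K : ℝ) + 1)) ^ K)| < ε) := by
  have : NeZero K := ⟨by omega⟩
  refine ⟨fun v hv h0 hp => ⟨D2D.exists_tendsto_performanceRatio hv h0 hp,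
    D2D.le_uniformBound hK hv.monotone h0 hp⟩, ?_, D2D.abs_exp_bound, ?_⟩
  · exact sub_le_sub_left (D2D.survival_pow_le_exp hK) 1
  · exact fun ε hε => ⟨ε, hε, fun v hv h0 hr =>
      D2D.abs_uniformBound_sub_lt hK hε hv.monotone h0 hr⟩
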